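/- Setting. Let $G=(\mathcal V,\mathcal E)$ be a directed network of $n=|\mathcal V|$ agents (self-links are ignored), $f\ge 0$, and let $\mathcal F\subset\mathcal V$, $|\mathcal F|=\phi\le f$, be the set of Byzantine (faulty) agents. Let $\Theta$ be a finite set of $m$ states with true state $\theta^*\in\Theta$. Agent $i$ has a finite signal space $\mathcal S_i$ and marginal distributions $\ell_i(\cdot\mid\theta)$, $\theta\in\Theta$, with full support; at each time $t\ge1$ it observes a signal $s^i_t$, and for each non-faulty $i$ the signals $s^i_1,s^i_2,\dots$ are i.i.d. with law $\ell_i(\cdot\mid\theta^*)$. Write $D_i(\theta)=\sum_{\omega\in\mathcal S_i}\ell_i(\omega\mid\theta^*)\log\frac{\ell_i(\omega\mid\theta^*)}{\ell_i(\omega\mid\theta)}$. Algorithm. Each non-faulty agent $i$ keeps a belief $\mu^i_t$ on $\Theta$, with $\mu^i_0(\theta)=1/m$. In round $t\ge 1$ it sends $x^i=\log\mu^i_{t-1}\in\mathbb R^\Theta$ on its outgoing links and receives a multiset $R^i$ of vectors, one from each in-neighbour (faulty in-neighbours send arbitrary vectors, possibly different ones to different agents). For every sub-multiset $C$ of $R^i\cup\{x^i\}$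 with $|C|=(m+1)f+1$ (vectors being labelled by their senders) it adds to the multiset $Z^i$ some Tverberg point of $C$, i.e. a point lying in the convex hull of each part of some partition of $C$ into $f+1$ parts. Then it puts $\eta^i_t=\frac1{1+|Z^i|}\bigl(x^i+\sum_{z\in Z^i}z\bigr)$, observes $s^i_t$, and sets $$\mu^i_t(\theta)=\frac{\prod_{k=1}^t\ell_i(s^i_k\mid\theta)\,e^{\eta^i_t(\theta)}}{\sum_{\theta'\in\Theta}\prod_{k=1}^t\ell_i(s^i_k\mid\theta')\,e^{\eta^i_t(\theta')}} .$$ Reduced graphs. A reduced graph of $G$ is obtained by removing $\mathcal F$ with all incident links and then, at each non-faulty agent, up to $mf$ further incoming links. A source component of a reduced graph is a non-empty strongly connected set of agents without incoming links from outside the set. Let $r_f$ be the number of reduced graphs and $\nu=r_f(n-\phi)$. Theorem. Assume: 1. every reduced graph has a source component, and each of its agents belongs to a source component or is reached from one by a directed path; 2. for every $\theta\ne\theta^*$, every reduced graph and every source component $P$ of it, $\sum_{j\in P}D_j(\theta)\ne0$; 3. every non-faulty agent $i$ with fewer than $(m+1)f$ in-neighbours in $G$ (such an agent forms no Tverberg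 point, hence never uses what it receives) satisfies $D_i(\theta)\neq 0$ for all $\theta\ne\theta^*$. (This is void if all non-faulty agents have at least $(m+1)f$ in-neighbours.) Let $C_1$ be the minimum of $\sum_{j\in P}D_j(\theta)$ over $\theta\ne\theta^*$ and all $P$ that are source components of reduced graphs or singletons $\{i\}$ with $i$ as in 3. Then there is $\beta\in(0,1)$, depending only on $(G,\mathcal F,f,\Theta)$, such that, whatever the faulty agents send and whichever Tverberg points are chosen, for every non-faulty agent $i$ and every $\theta\ne\theta^*$, almost surely $$\mu^i_t(\theta)\to0\qquad\text{and}\qquad \frac1{t^2}\log\frac{\mu^i_t(\theta)}{\mu^i_t(\theta^*)}\le-\frac{\beta^{\nu}C_1}{2n}\ \text{ for all sufficiently large } t .$$ Uniqueness of the source component (network consensus) is not required. -/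

import Mathlib

open Filter Topology MeasureTheory ProbabilityTheory

noncomputable section

namespace ByzantineLearning

universe u v w

/-! ### The network. `G.Adj j i` is the link from `j` to `i`; `m` is the number of states. -/

section Network

variable {V : Type u} [Fintype V]

open scoped Classical in
/-- The agents, other than `i`, that have a link to `i`. -/
def inNbrs (G : Digraph V) (i : V) : Finset V :=
  Finset.univ.filter fun j => j ≠ i ∧ G.Adj j i

open scoped Classical in
/-- The index sets `C` over which agent `i` forms Tverberg points: the sub-multisets with
`(m + 1) f + 1` members of the multiset of vectors held by `i` (its own and the received ones),
each vector being labelled by the agent it comes from. -/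
def tverbergFamily (G : Digraph V) (f m : ℕ) (i : V) : Finset (Finset V) :=
  Finset.powersetCard ((m + 1) * f + 1) (insert i (inNbrs G i))

open scoped Classical in
/-- `H` is a reduced graph of `G` for the fault set `F`: all links incident on `F` are removed, and
at every non-faulty agent at most `m * f` further incoming links are removed. The agents of `H` are
those outside `F`. -/
structure IsReducedGraph (G : Digraph V) (F : Finset V) (f m : ℕ) (H : Digraph V) : Prop where
  sub : ∀ j i, H.Adj j i → G.Adj j i ∧ j ∉ F ∧ i ∉ F
  removed : ∀ i, i ∉ F →
    (Finset.univ.filter fun j => j ∉ F ∧ G.Adj j i ∧ ¬ H.Adj j i).card ≤ m * f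

/-- A source component: a non-empty strongly connected set of non-faulty agents without incoming
links from outside the set. -/
structure IsSourceComponent (F : Finset V) (H : Digraph V) (P : Finset V) : Prop where
  nonempty : P.Nonempty
  nonfaulty : ∀ j ∈ P, j ∉ F
  stronglyConnected : ∀ a ∈ P, ∀ b ∈ P, Relation.ReflTransGen H.Adj a b
  noIncoming : ∀ a, a ∉ P → ∀ b ∈ P, ¬ H.Adj a b

/-- Every reduced graph has a source component, and each of its agents is in a source component
or is reached by a directed path from one. -/
def SourcesReachAll (G : Digraph V) (F : Finset V) (f m : ℕ) : Prop :=
  ∀ H, IsReducedGraph G F f m H →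
    (∃ P, IsSourceComponent F H P) ∧
    ∀ i, i ∉ F → ∃ P, IsSourceComponent F H P ∧
      (i ∈ P ∨ ∃ j ∈ P, Relation.TransGen H.Adj j i)

/-- The number of reduced graphs. -/
def numReduced (G : Digraph V) (F : Finset V) (f m : ℕ) : ℕ :=
  {H : Digraph V | IsReducedGraph G F f m H}.ncard

/-- `ν`: the number of reduced graphs times the number of non-faulty agents. -/
def nu (G : Digraph V) (F : Finset V) (f m : ℕ) : ℕ :=
  numReduced G F f m * (Fintype.card V - F.card)

/-- Agent `i` holds fewer than `(m + 1) f + 1` vectors, its own included, so that it forms no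
Tverberg point and never uses what it receives. -/
def IsStarved (G : Digraph V) (f m : ℕ) (i : V) : Prop :=
  (inNbrs G i).card < (m + 1) * f

end Network

/-! ### Signals -/

section Signals

variable {V : Type u} [Fintype V] {Θ : Type v} [Fintype Θ] {S : V → Type w} [∀ i, Fintype (S i)]

/-- The Kullback-Leibler divergence `D(ℓ_j(·|θ₀) ‖ ℓ_j(·|θ))`. -/
def klDivergence (ℓ : (i : V) → Θ → S i → ℝ) (j : V) (θ₀ θ : Θ) : ℝ :=
  ∑ x : S j, ℓ j θ₀ x * Real.log (ℓ j θ₀ x / ℓ j θ x)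

/-- Every source component of every reduced graph can collectively distinguish `θ₀` from any other
state. -/
def SourcesDistinguish (G : Digraph V) (F : Finset V) (f : ℕ) (ℓ : (i : V) → Θ → S i → ℝ)
    (θ₀ : Θ) : Prop :=
  ∀ θ, θ ≠ θ₀ → ∀ H, IsReducedGraph G F f (Fintype.card Θ) H → ∀ P, IsSourceComponent F H P →
    ∑ j ∈ P, klDivergence ℓ j θ₀ θ ≠ 0

/-- `C₁`: the minimum, over the states `θ ≠ θ₀` and the source components `P` of reduced graphs, of
the divergence summed over `P`; a non-faulty agent that forms no Tverberg point counts as a source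
of its own. (If no non-faulty agent is starved, only the source components remain.) -/
def minDivergence (G : Digraph V) (F : Finset V) (f : ℕ) (ℓ : (i : V) → Θ → S i → ℝ)
    (θ₀ : Θ) : ℝ :=
  sInf {c : ℝ | ∃ θ, θ ≠ θ₀ ∧ ∃ P : Finset V,
    ((∃ H, IsReducedGraph G F f (Fintype.card Θ) H ∧ IsSourceComponent F H P) ∨
      ∃ i, i ∉ F ∧ IsStarved G f (Fintype.card Θ) i ∧ P = {i}) ∧
    c = ∑ j ∈ P, klDivergence ℓ j θ₀ θ}

end Signals

/-! ### The algorithm -/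

/-- `z` is a Tverberg point of the multiset of the vectors `x j`, `j ∈ C`: the multiset can be
split into `f + 1` parts such that `z` lies in the convex hull of each part. -/
def IsTverbergPoint {V : Type u} {Θ : Type v} (f : ℕ) (C : Finset V) (x : V → Θ → ℝ)
    (z : Θ → ℝ) : Prop :=
  ∃ part : V → Fin (f + 1), ∀ k, z ∈ convexHull ℝ (x '' {j | j ∈ C ∧ part j = k})

/-- A run of the algorithm on the network `G` with faulty agents `F`, where `sig t i` is the signal
that agent `i` observes at time `t ≥ 1`. What the agents of `F` send, possibly different vectors to
different agents, is arbitrary, and so is the choice of the Tverberg points. Only the entries of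
non-faulty agents at times `t ≥ 1` matter (and `t = 0` for the beliefs). -/
structure Run {V : Type u} [Fintype V] {Θ : Type v} [Fintype Θ] {S : V → Type w}
    (G : Digraph V) (F : Finset V) (f : ℕ) (ℓ : (i : V) → Θ → S i → ℝ)
    (sig : ℕ → (i : V) → S i) where
  /-- `belief t i θ` is `μ_t^i(θ)`. -/
  belief : ℕ → V → Θ → ℝ
  /-- `held t i j` is the vector that `i` has received from `j` at time `t`
  (its own one if `j = i`). -/
  held : ℕ → V → V → Θ → ℝ
  /-- `point t i C` is the Tverberg point that `i` has chosen for `C` at time `t`. -/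
  point : ℕ → V → Finset V → Θ → ℝ
  /-- `eta t i` is `η_t^i`. -/
  eta : ℕ → V → Θ → ℝ
  init : ∀ i, i ∉ F → ∀ θ, belief 0 i θ = 1 / (Fintype.card Θ : ℝ)
  held_self : ∀ t i, i ∉ F → ∀ θ, held (t + 1) i i θ = Real.log (belief t i θ)
  held_honest : ∀ t i, i ∉ F → ∀ j ∈ inNbrs G i, j ∉ F → ∀ θ,
    held (t + 1) i j θ = Real.log (belief t j θ)
  isTverberg : ∀ t i, i ∉ F → ∀ C ∈ tverbergFamily G f (Fintype.card Θ) i,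
    IsTverbergPoint f C (held (t + 1) i) (point (t + 1) i C)
  eta_eq : ∀ t i, i ∉ F → ∀ θ,
    eta (t + 1) i θ = 1 / (1 + ((tverbergFamily G f (Fintype.card Θ) i).card : ℝ)) *
      (Real.log (belief t i θ) +
        ∑ C ∈ tverbergFamily G f (Fintype.card Θ) i, point (t + 1) i C θ)
  update : ∀ t i, i ∉ F → ∀ θ,
    belief (t + 1) i θ =
      (∏ k ∈ Finset.Icc 1 (t + 1), ℓ i θ (sig k i)) * Real.exp (eta (t + 1) i θ) /
        ∑ θ' : Θ, (∏ k ∈ Finset.Icc 1 (t + 1), ℓ i θ' (sig k i)) * Real.exp (eta (t + 1) i θ')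

end ByzantineLearning

end

namespace ByzantineLearning

/-! Fix `θ ≠ θ₀` and let `ψ t i` be the log-ratio of the beliefs in `θ` and `θ₀`. One of the `f + 1`
parts of a Tverberg partition contains no faulty vector, so every Tverberg point is a convex
combination of non-faulty vectors. The normalisation cancels in the ratio, and `ψ` obeys a linear
recursion `ψ (t + 1) = A t ψ t + L (t + 1)` with stochastic matrices `A t`. Since the whole signal
history enters every round, the strong law gives `L t i ≈ -t D i`, where `D i` is the divergence at
`i`.

Unrolling, `ψ t` is at most about `-∑ r • A (t - 1) ⋯ A r D`, summed over `r ≤ t`. It suffices that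
`n` rounds of averaging lift every non-faulty entry of `D` to at least `α ^ n * δ`, with `δ = C₁ /
n` (`pow_mul_le_propagate`); summing `r` then gives the factor `t ^ 2 / 2`. The links of weight at
least `α` in one round essentially form a reduced graph, each of whose source components contains an
agent with `D ≥ δ`. The set of agents already lifted contains all such agents from the start, so
while it is incomplete some heavy link leaves it, and it grows in each round. Only this lower bound
is needed, not convergence of the matrix products; hence consensus plays no role. -/

/-! ### Tverberg points as convex combinations of non-faulty vectors -/

/-- A point in the convex hull of an indexed family is given by weights on the index set. -/
theorem exists_weights_of_mem_convexHull_image {V Θ : Type*} [Fintype V] {s : Set V}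
    {x : V → Θ → ℝ} {z : Θ → ℝ} (hz : z ∈ convexHull ℝ (x '' s)) :
    ∃ w : V → ℝ, (∀ j, 0 ≤ w j) ∧ (∀ j, j ∉ s → w j = 0) ∧ ∑ j, w j = 1 ∧
      ∀ θ, z θ = ∑ j, w j * x j θ := by
  classical
  let K : Set (Θ → ℝ) := {z | ∃ w : V → ℝ, (∀ j, 0 ≤ w j) ∧ (∀ j, j ∉ s → w j = 0) ∧
    ∑ j, w j = 1 ∧ ∀ θ, z θ = ∑ j, w j * x j θ}
  have hK : Convex ℝ K := by
    rintro z₁ ⟨w₁, hn₁, hs₁, ht₁, hz₁⟩ z₂ ⟨w₂, hn₂, hs₂, ht₂, hz₂⟩ a b ha hb hab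
    refine ⟨fun j => a * w₁ j + b * w₂ j, fun j => ?_, fun j hj => ?_, ?_, fun θ => ?_⟩
    · have := hn₁ j
      have := hn₂ j
      positivity
    · simp [hs₁ j hj, hs₂ j hj]
    · rw [Finset.sum_add_distrib, ← Finset.mul_sum, ← Finset.mul_sum, ht₁, ht₂]
      simpa using hab
    · simp only [Pi.add_apply, Pi.smul_apply, smul_eq_mul, hz₁, hz₂, Finset.mul_sum,
        ← Finset.sum_add_distrib]
      exact Finset.sum_congr rfl fun j _ => by ring
  refine convexHull_min (t := K) ?_ hK hz
  rintro _ ⟨j, hj, rfl⟩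
  refine ⟨Pi.single j 1, fun k => ?_, fun k hk => ?_, ?_, fun θ => ?_⟩
  · by_cases h : k = j
    · subst h; simp
    · simp [h]
  · have h : k ≠ j := fun h => hk (h ▸ hj)
    simp [h]
  · simp
  · simp [Pi.single_apply]

/-- If a set is split into `f + 1` parts, some part avoids any given `f` members. -/
theorem exists_part_subset {V : Type*} [DecidableEq V] {f : ℕ} {C B : Finset V}
    (h : (C \ B).card ≤ f) (part : V → Fin (f + 1)) :
    ∃ k, ∀ j ∈ C, part j = k → j ∈ B := by
  by_contra! hc
  choose g hgC hgk hgB using hc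
  have hinj : Function.Injective g := fun a b hab => by rw [← hgk a, hab, hgk b]
  have hsub : Finset.univ.map ⟨g, hinj⟩ ⊆ C \ B := by
    intro j hj
    obtain ⟨k, -, rfl⟩ := Finset.mem_map.1 hj
    exact Finset.mem_sdiff.2 ⟨hgC k, hgB k⟩
  have := Finset.card_le_card hsub
  rw [Finset.card_map, Finset.card_univ, Fintype.card_fin] at this
  omega

/-- A Tverberg point is a convex combination of the non-faulty vectors that gives a substantial
weight to some member of every set missing at most `f` of the vectors. -/
theorem IsTverbergPoint.exists_weights {V Θ : Type*} [Fintype V] [DecidableEq V] {f : ℕ}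
    {C F : Finset V} {x : V → Θ → ℝ} {z : Θ → ℝ} (h : IsTverbergPoint f C x z) (hF : F.card ≤ f) :
    ∃ w : V → ℝ, (∀ j, 0 ≤ w j) ∧ (∀ j, j ∉ C \ F → w j = 0) ∧ ∑ j, w j = 1 ∧
      (∀ θ, z θ = ∑ j, w j * x j θ) ∧
      ∀ B ⊆ C \ F, (C \ B).card ≤ f → ∃ j ∈ B, 1 / (((f + 1 : ℕ) : ℝ) * C.card) ≤ w j := by
  obtain ⟨part, hpart⟩ := h
  choose u hu0 hus hu1 huz using fun k => exists_weights_of_mem_convexHull_image (hpart k)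
  simp only [Set.mem_ofPred_eq, not_and] at hus
  -- The part that lies inside `B` depends on `B`, but one representation of `z` must serve all `B`.
  -- Averaging over all fault-free parts achieves this, at the cost of a factor at most `f + 1`.
  let K : Finset (Fin (f + 1)) := Finset.univ.filter fun k => ∀ j ∈ C, part j = k → j ∈ C \ F
  have hCF : (C \ (C \ F)).card ≤ f := by
    refine (Finset.card_le_card fun j hj => ?_).trans hF
    simp only [Finset.mem_sdiff, not_and, not_not] at hj
    exact hj.2 hj.1
  have hK : 0 < K.card := by
    obtain ⟨k, hk⟩ := exists_part_subset hCF part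
    exact Finset.card_pos.2 ⟨k, by simpa [K] using hk⟩
  have hK' : (0 : ℝ) < K.card := by exact_mod_cast hK
  have hKle : (K.card : ℝ) ≤ ((f + 1 : ℕ) : ℝ) := by
    have := K.card_le_univ
    rw [Fintype.card_fin] at this
    exact_mod_cast this
  refine ⟨fun j => (∑ k ∈ K, u k j) / K.card, fun j => ?_, fun j hj => ?_, ?_, fun θ => ?_,
    fun B hB hcard => ?_⟩
  · exact div_nonneg (Finset.sum_nonneg fun k _ => hu0 k j) hK'.le
  · refine div_eq_zero_iff.2 (.inl (Finset.sum_eq_zero fun k hk => ?_))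
    exact hus k j fun hjC hjk => hj ((Finset.mem_filter.1 hk).2 j hjC hjk)
  · rw [← Finset.sum_div, Finset.sum_comm]
    simp [hu1, hK'.ne']
  · simp only [div_mul_eq_mul_div, ← Finset.sum_div, Finset.sum_mul]
    rw [Finset.sum_comm, eq_div_iff hK'.ne', Finset.sum_congr rfl fun k _ => (huz k θ).symm]
    simp [mul_comm]
  · obtain ⟨k, hk⟩ := exists_part_subset hcard part
    have hkK : k ∈ K := Finset.mem_filter.2 ⟨Finset.mem_univ _, fun j hj hjk => hB (hk j hj hjk)⟩
    have hsum : ∑ j ∈ B, u k j = 1 := by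
      rw [← hu1 k]
      exact Finset.sum_subset (Finset.subset_univ _) fun j _ hj =>
        hus k j fun hjC hjk => hj (hk j hjC hjk)
    have hBC : (B.card : ℝ) ≤ C.card := by
      exact_mod_cast Finset.card_le_card (hB.trans Finset.sdiff_subset)
    have hBne : B.Nonempty := by
      rw [Finset.nonempty_iff_ne_empty]
      rintro rfl
      simp at hsum
    have hBpos : (0 : ℝ) < B.card := by exact_mod_cast hBne.card_pos
    obtain ⟨j, hj, hjle⟩ : ∃ j ∈ B, 1 / (B.card : ℝ) ≤ u k j := by
      by_contra! hlt
      have := Finset.sum_lt_sum_of_nonempty hBne hlt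
      rw [hsum, Finset.sum_const, nsmul_eq_mul, mul_one_div_cancel hBpos.ne'] at this
      exact lt_irrefl _ this
    refine ⟨j, hj, ?_⟩
    have h1 : u k j ≤ ∑ k ∈ K, u k j := Finset.single_le_sum (fun k _ => hu0 k j) hkK
    calc 1 / (((f + 1 : ℕ) : ℝ) * C.card) ≤ 1 / (K.card * B.card) := by gcongr
      _ = 1 / B.card / K.card := by rw [div_div, mul_comm]
      _ ≤ _ := div_le_div_of_nonneg_right (hjle.trans h1) hK'.le

/-! ### The averaging matrices -/

/-- A lower bound for the weights that the algorithm uses. -/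
noncomputable def weightBound (n f m : ℕ) : ℝ :=
  1 / (1 + 2 ^ n) * (1 / (((f + 1 : ℕ) : ℝ) * (((m + 1) * f + 1 : ℕ) : ℝ)))

theorem weightBound_pos (n f m : ℕ) : 0 < weightBound n f m := by
  unfold weightBound
  positivity

theorem weightBound_le (n f m : ℕ) : weightBound n f m ≤ 1 / (1 + 2 ^ n) := by
  unfold weightBound
  refine mul_le_of_le_one_right (by positivity) ?_
  rw [div_le_one (by positivity)]
  norm_cast
  nlinarith [Nat.zero_le ((m + 1) * f), Nat.zero_le f]

theorem weightBound_le_one (n f m : ℕ) : weightBound n f m ≤ 1 := by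
  refine (weightBound_le n f m).trans ?_
  rw [div_le_one (by positivity)]
  have : (0 : ℝ) < 2 ^ n := by positivity
  linarith

open scoped Classical in
/-- The properties of the row with which a non-faulty agent `i` averages the vectors: a convex
combination of non-faulty vectors that gives weight at least `α` to the agent itself and, if the
agent is not starved, to all but `m * f` of its non-faulty in-neighbours. -/
structure IsAveragingRow {V : Type*} [Fintype V] (G : Digraph V) (F : Finset V) (f m : ℕ) (α : ℝ)
    (i : V) (a : V → ℝ) : Prop where
  nonneg : ∀ j, 0 ≤ a j
  sum_eq_one : ∑ j, a j = 1
  faulty : ∀ j ∈ F, a j = 0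
  self : α ≤ a i
  light : ¬ IsStarved G f m i →
    (Finset.univ.filter fun j => j ∉ F ∧ j ≠ i ∧ G.Adj j i ∧ a j < α).card ≤ m * f

/-- Substitute for each Tverberg point its fault-free representation. The index sets are subsets of
`V`, so there are at most `2 ^ n` of them, which accounts for the factor `1 / (1 + 2 ^ n)` in
`weightBound`. -/
theorem Run.exists_averagingRow {V : Type*} [Fintype V] {Θ : Type*} [Fintype Θ] {S : V → Type*}
    {G : Digraph V} {F : Finset V} {f : ℕ} {ℓ : (i : V) → Θ → S i → ℝ}
    {sig : ℕ → (i : V) → S i} (run : Run G F f ℓ sig) (hF : F.card ≤ f) (t : ℕ) {i : V}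
    (hi : i ∉ F) :
    ∃ a : V → ℝ, IsAveragingRow G F f (Fintype.card Θ)
        (weightBound (Fintype.card V) f (Fintype.card Θ)) i a ∧
      ∀ θ, run.eta (t + 1) i θ = ∑ j, a j * Real.log (run.belief t j θ) := by
  classical
  set m := Fintype.card Θ
  set Z := tverbergFamily G f m i with hZdef
  have hmem : ∀ C, C ∈ Z ↔ C ⊆ insert i (inNbrs G i) ∧ C.card = (m + 1) * f + 1 := fun C => by
    rw [hZdef, tverbergFamily, Finset.mem_powersetCard]
  have hw : ∀ C, ∃ w : V → ℝ, C ∈ Z → (∀ j, 0 ≤ w j) ∧ (∀ j, j ∉ C \ F → w j = 0) ∧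
      ∑ j, w j = 1 ∧ (∀ θ, run.point (t + 1) i C θ = ∑ j, w j * run.held (t + 1) i j θ) ∧
      ∀ B ⊆ C \ F, (C \ B).card ≤ f → ∃ j ∈ B, 1 / (((f + 1 : ℕ) : ℝ) * C.card) ≤ w j := by
    intro C
    by_cases hC : C ∈ Z
    · obtain ⟨w, hw⟩ := (run.isTverberg t i hi C hC).exists_weights hF
      exact ⟨w, fun _ => hw⟩
    · exact ⟨0, fun h => absurd h hC⟩
  choose w hw using hw
  have hZcard : (Z.card : ℝ) ≤ 2 ^ Fintype.card V := by
    have := Z.card_le_univ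
    rw [Fintype.card_finset] at this
    exact_mod_cast this
  have hpos : (0 : ℝ) < 1 + Z.card := by positivity
  have hbound : 1 / (1 + 2 ^ Fintype.card V) ≤ 1 / (1 + (Z.card : ℝ)) := by gcongr
  have hwsum : ∀ j, 0 ≤ ∑ C ∈ Z, w C j := fun j => Finset.sum_nonneg fun C hC => (hw C hC).1 j
  have hone : ∀ j, (0 : ℝ) ≤ if j = i then 1 else 0 := fun j => by split_ifs <;> norm_num
  refine ⟨fun j => 1 / (1 + (Z.card : ℝ)) * ((if j = i then 1 else 0) + ∑ C ∈ Z, w C j),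
    ⟨fun j => ?_, ?_, fun j hj => ?_, ?_, fun hs => ?_⟩, fun θ => ?_⟩
  · have := hwsum j
    have := hone j
    positivity
  · rw [← Finset.mul_sum, Finset.sum_add_distrib, Finset.sum_comm,
      Finset.sum_congr rfl fun C hC => (hw C hC).2.2.1]
    simp [hpos.ne']
  · have hji : j ≠ i := fun h => hi (h ▸ hj)
    rw [Finset.sum_eq_zero fun C hC => (hw C hC).2.1 j fun h => (Finset.mem_sdiff.1 h).2 hj]
    simp [hji]
  · refine ((weightBound_le _ _ _).trans hbound).trans ?_
    refine le_mul_of_one_le_right (by positivity) ?_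
    simpa using hwsum i
  -- Given `m * f + 1` light neighbours `B`, enlarge `B` by `f` vectors to an admissible `C`. Some
  -- part of `C` lies within `B`, so the Tverberg point of `C` gives a member of `B` too much
  -- weight.
  · by_contra! hcard
    obtain ⟨B, hBsub, hBcard⟩ := Finset.exists_subset_card_eq hcard
    have hBN : B ⊆ insert i (inNbrs G i) := fun j hj => by
      have := (Finset.mem_filter.1 (hBsub hj)).2
      simp [inNbrs, this.2.1, this.2.2.1]
    have hN : (m + 1) * f + 1 ≤ (insert i (inNbrs G i)).card := by
      rw [Finset.card_insert_of_notMem (by simp [inNbrs])]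
      unfold IsStarved at hs
      omega
    have hexp : (m + 1) * f + 1 = B.card + f := by rw [hBcard, Nat.succ_eq_add_one]; ring
    obtain ⟨C, hBC, hCN, hCcard⟩ := Finset.exists_subsuperset_card_eq hBN (by omega) hN
    have hC : C ∈ Z := (hmem C).2 ⟨hCN, hCcard⟩
    obtain ⟨j, hjB, hj⟩ := (hw C hC).2.2.2.2 B
      (fun j hj => Finset.mem_sdiff.2 ⟨hBC hj, (Finset.mem_filter.1 (hBsub hj)).2.1⟩)
      (by rw [Finset.card_sdiff_of_subset hBC]; omega)
    have hlt := (Finset.mem_filter.1 (hBsub hjB)).2.2.2.2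
    refine hlt.not_ge ?_
    unfold weightBound
    rw [hCcard] at hj
    have h1 : w C j ≤ ∑ C ∈ Z, w C j :=
      Finset.single_le_sum (f := fun C => w C j) (fun C hC => (hw C hC).1 j) hC
    have := hone j
    gcongr
    linarith
  · rw [run.eta_eq t i hi θ, ← hZdef]
    have hp : ∀ C ∈ Z, run.point (t + 1) i C θ = ∑ j, w C j * Real.log (run.belief t j θ) := by
      intro C hC
      rw [(hw C hC).2.2.2.1 θ]
      refine Finset.sum_congr rfl fun j _ => ?_
      by_cases hj : j ∈ C \ F
      · obtain ⟨hjC, hjF⟩ := Finset.mem_sdiff.1 hj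
        congr 1
        rcases Finset.mem_insert.1 (((hmem C).1 hC).1 hjC) with rfl | hjN
        · exact run.held_self t j hi θ
        · exact run.held_honest t i hi j hjN hjF θ
      · simp [(hw C hC).2.1 j hj]
    rw [Finset.sum_congr rfl hp, Finset.sum_comm]
    simp only [mul_assoc, ← Finset.mul_sum, add_mul, Finset.sum_add_distrib, Finset.sum_mul]
    simp

/-! ### Repeated averaging -/

/-- The links that carry weight at least `α` form a reduced graph (self-links and all links into
starved agents being kept). -/
theorem isReducedGraph_of_averagingRows {V : Type*} [Fintype V] {G : Digraph V} {F : Finset V}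
    {f m : ℕ} {α : ℝ} {A : V → V → ℝ} (hA : ∀ i, i ∉ F → IsAveragingRow G F f m α i (A i)) :
    IsReducedGraph G F f m ⟨fun j i => G.Adj j i ∧ j ∉ F ∧ i ∉ F ∧
      (IsStarved G f m i ∨ j = i ∨ α ≤ A i j)⟩ where
  sub j i h := ⟨h.1, h.2.1, h.2.2.1⟩
  removed i hi := by
    -- A starved agent may have more than `m * f` in-neighbours, all without weight, so its links
    -- cannot be discarded.
    by_cases hs : IsStarved G f m i
    · refine (Finset.card_eq_zero.2 (Finset.eq_empty_of_forall_notMem fun j hj => ?_)).trans_le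
        (Nat.zero_le _)
      simp only [Finset.mem_filter, Finset.mem_univ, true_and] at hj
      exact hj.2.2 ⟨hj.2.1, hj.1, hi, .inl hs⟩
    · refine (Finset.card_le_card fun j hj => ?_).trans ((hA i hi).light hs)
      simp only [Finset.mem_filter, Finset.mem_univ, true_and, not_and, not_or, not_le] at hj ⊢
      have := hj.2.2 hj.2.1 hj.1 hi
      exact ⟨hj.1, this.2.1, hj.2.1, this.2.2⟩

/-- The vector obtained from `D` by averaging successively with `A 0, A 1, …`. -/
def propagate {V : Type*} [Fintype V] (A : ℕ → V → V → ℝ) (D : V → ℝ) : ℕ → V → ℝ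
  | 0 => D
  | s + 1 => fun i => ∑ j, A s i j * propagate A D s j

theorem IsAveragingRow.le_sum {V : Type*} [Fintype V] {G : Digraph V} {F : Finset V} {f m : ℕ}
    {α : ℝ} {i : V} {a : V → ℝ} (ha : IsAveragingRow G F f m α i a) {y : V → ℝ} {c : ℝ}
    (hy : ∀ j, j ∉ F → c ≤ y j) : c ≤ ∑ j, a j * y j := by
  calc c = ∑ j, a j * c := by rw [← Finset.sum_mul, ha.sum_eq_one, one_mul]
    _ ≤ _ := Finset.sum_le_sum fun j _ => by
      by_cases hj : j ∈ F
      · simp [ha.faulty j hj]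
      · exact mul_le_mul_of_nonneg_left (hy j hj) (ha.nonneg j)

theorem IsAveragingRow.mul_le_sum {V : Type*} [Fintype V] {G : Digraph V} {F : Finset V} {f m : ℕ}
    {α : ℝ} {i : V} {a : V → ℝ} (ha : IsAveragingRow G F f m α i a) {y : V → ℝ}
    (hy : ∀ j, j ∉ F → 0 ≤ y j) {c : ℝ} (hc : 0 ≤ c) {k : V} (hk : α ≤ a k) (hky : c ≤ y k) :
    α * c ≤ ∑ j, a j * y j := by
  calc α * c ≤ a k * y k := mul_le_mul hk hky hc (ha.nonneg k)
    _ ≤ _ := Finset.single_le_sum (f := fun j => a j * y j) (fun j _ => by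
      by_cases hj : j ∈ F
      · simp [ha.faulty j hj]
      · exact mul_nonneg (ha.nonneg j) (hy j hj)) (Finset.mem_univ k)

theorem propagate_nonneg {V : Type*} [Fintype V] {G : Digraph V} {F : Finset V} {f m : ℕ}
    {α : ℝ} {A : ℕ → V → V → ℝ} (hA : ∀ t i, i ∉ F → IsAveragingRow G F f m α i (A t i))
    {D : V → ℝ} (hD : ∀ i, i ∉ F → 0 ≤ D i) (s : ℕ) : ∀ i, i ∉ F → 0 ≤ propagate A D s i := by
  induction s with
  | zero => exact hD
  | succ s ih => exact fun i hi => (hA s i hi).le_sum ih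

/-- A path from inside a set to outside of it has a link that leaves the set. -/
theorem exists_step_of_reflTransGen {V : Type*} {r : V → V → Prop} {K : V → Prop} {a b : V}
    (h : Relation.ReflTransGen r a b) (ha : K a) (hb : ¬ K b) :
    ∃ c d, r c d ∧ K c ∧ ¬ K d := by
  induction h with
  | refl => exact absurd ha hb
  | @tail c d _ hcd ih =>
    by_cases hc : K c
    · exact ⟨c, d, hcd, hc, hb⟩
    · exact ih hc

/-- If every source component and every starved agent starts with a value at least `δ`, after `n`
rounds all non-faulty agents have a value at least `α ^ n * δ`. -/
theorem pow_mul_le_propagate {V : Type*} [Fintype V] {G : Digraph V} {F : Finset V} {f m : ℕ}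
    (hreach : SourcesReachAll G F f m) {α : ℝ} (hα : 0 < α) {A : ℕ → V → V → ℝ}
    (hA : ∀ t i, i ∉ F → IsAveragingRow G F f m α i (A t i))
    {D : V → ℝ} (hD : ∀ i, i ∉ F → 0 ≤ D i) {δ : ℝ} (hδ : 0 ≤ δ)
    (hsource : ∀ H, IsReducedGraph G F f m H → ∀ P, IsSourceComponent F H P → ∃ j ∈ P, δ ≤ D j)
    (hstarved : ∀ i, i ∉ F → IsStarved G f m i → δ ≤ D i) {s : ℕ} (hs : Fintype.card V ≤ s)
    {i : V} (hi : i ∉ F) : α ^ Fintype.card V * δ ≤ propagate A D s i := by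
  classical
  have hnn := propagate_nonneg hA hD
  let K : ℕ → Finset V := fun s =>
    Finset.univ.filter fun i => i ∉ F ∧ α ^ s * δ ≤ propagate A D s i
  have hKmem : ∀ s i, i ∈ K s ↔ i ∉ F ∧ α ^ s * δ ≤ propagate A D s i := by simp [K]
  have hstep : ∀ s i k, i ∉ F → k ∈ K s → α ≤ A s i k → i ∈ K (s + 1) := by
    intro s i k hi hk hik
    rw [hKmem] at hk ⊢
    refine ⟨hi, ?_⟩
    have := (hA s i hi).mul_le_sum (hnn s) (by positivity) hik hk.2
    calc α ^ (s + 1) * δ = α * (α ^ s * δ) := by ring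
      _ ≤ _ := this
  have hmono : ∀ s, K s ⊆ K (s + 1) := fun s i hi =>
    hstep s i i ((hKmem s i).1 hi).1 hi ((hA s i ((hKmem s i).1 hi).1).self)
  have hzero : ∀ s, K 0 ⊆ K s := fun s => by
    induction s with
    | zero => exact subset_rfl
    | succ s ih => exact ih.trans (hmono s)
  have hinit : ∀ i, i ∉ F → δ ≤ D i → i ∈ K 0 := fun i hi h =>
    (hKmem 0 i).2 ⟨hi, by simpa [propagate] using h⟩
  have hgrow : ∀ s, (∀ i, i ∉ F → i ∈ K s) ∨ s ≤ (K s).card := by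
    intro s
    induction s with
    | zero => exact .inr (Nat.zero_le _)
    | succ s ih =>
      rcases ih with hall | hcard
      · exact .inl fun i hi => hmono s (hall i hi)
      by_cases hall : ∀ i, i ∉ F → i ∈ K s
      · exact .inl fun i hi => hmono s (hall i hi)
      push Not at hall
      obtain ⟨i, hiF, hiK⟩ := hall
      -- The reduced graph changes from round to round, but whichever source component this one
      -- offers contains an agent with `D ≥ δ`, which has been in `K` since time `0`.
      obtain ⟨P, hP, hPi⟩ := (hreach _ (isReducedGraph_of_averagingRows (hA s))).2 i hiF
      obtain ⟨j, hjP, hj⟩ := hsource _ (isReducedGraph_of_averagingRows (hA s)) P hP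
      have hjK : j ∈ K s := hzero s (hinit j (hP.nonfaulty j hjP) hj)
      have hpath := show Relation.ReflTransGen _ j i from by
        rcases hPi with hiP | ⟨k, hkP, hki⟩
        · exact hP.stronglyConnected j hjP i hiP
        · exact (hP.stronglyConnected j hjP k hkP).trans hki.to_reflTransGen
      obtain ⟨c, d, hcd, hc, hd⟩ := exists_step_of_reflTransGen (K := (· ∈ K s)) hpath hjK hiK
      obtain ⟨-, -, hdF, hd'⟩ := hcd
      have hdK : d ∈ K (s + 1) := by
        -- The link crossing the boundary of `K s` must be heavy: starved agents were in `K` from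
        -- the start, and a self-link crosses nothing.
        rcases hd' with hst | rfl | hw
        · exact absurd (hzero s (hinit d hdF (hstarved d hdF hst))) hd
        · exact absurd hc hd
        · exact hstep s d c hdF hc hw
      have : (K s).card < (K (s + 1)).card :=
        Finset.card_lt_card ⟨hmono s, fun h => hd (h hdK)⟩
      exact .inr (by omega)
  -- The exponent stops at `n`, because averaging never lowers the minimum over the non-faulty
  -- agents.
  induction s, hs using Nat.le_induction generalizing i with
  | base =>
    rcases hgrow (Fintype.card V) with hall | hcard
    · exact ((hKmem _ i).1 (hall i hi)).2
    · have : K (Fintype.card V) = Finset.univ :=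
        (Finset.card_eq_iff_eq_univ _).1 (le_antisymm (Finset.card_le_univ _) hcard)
      exact ((hKmem _ i).1 (this ▸ Finset.mem_univ i)).2
  | succ s _ ih => exact (hA s i hi).le_sum fun j hj => ih hj

/-- A sequence driven by averaging and by the increments `L` with `L r ≤ - r D + b r` is bounded by
the superposition of the averaged increments. -/
theorem le_superposition {V : Type*} [Fintype V] {G : Digraph V} {F : Finset V} {f m : ℕ}
    {α : ℝ} {A : ℕ → V → V → ℝ} (hA : ∀ t i, i ∉ F → IsAveragingRow G F f m α i (A t i))
    {D : V → ℝ} {L ψ : ℕ → V → ℝ} {b : ℕ → ℝ} (hb : 0 ≤ b 0)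
    (hL : ∀ r i, i ∉ F → L r i ≤ -(r * D i) + b r)
    (hψ0 : ∀ i, i ∉ F → ψ 0 i = 0)
    (hψ : ∀ t i, i ∉ F → ψ (t + 1) i = ∑ j, A t i j * ψ t j + L (t + 1) i)
    (t : ℕ) : ∀ i, i ∉ F → ψ t i ≤
      -(∑ r ∈ Finset.range (t + 1), r * propagate (fun s => A (r + s)) D (t - r) i) +
        ∑ r ∈ Finset.range (t + 1), b r := by
  induction t with
  | zero => intro i hi; simpa [hψ0 i hi] using hb
  | succ t ih =>
    intro i hi
    have hle : ∑ r ∈ Finset.range (t + 1), r * propagate (fun s => A (r + s)) D (t + 1 - r) i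
        - ∑ r ∈ Finset.range (t + 1), b r ≤ -∑ j, A t i j * ψ t j := by
      -- The slack in the induction hypothesis is nonnegative, hence so is its average; the error
      -- terms pass unchanged since the row sums to `1`.
      have := (hA t i hi).le_sum (c := 0) (y := fun j => -ψ t j -
        ∑ r ∈ Finset.range (t + 1), r * propagate (fun s => A (r + s)) D (t - r) j +
        ∑ r ∈ Finset.range (t + 1), b r) fun j hj => by have := ih j hj; linarith
      simp only [mul_add, mul_sub, Finset.sum_add_distrib, Finset.sum_sub_distrib,
        ← Finset.sum_mul, (hA t i hi).sum_eq_one, one_mul, mul_neg, Finset.sum_neg_distrib] at this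
      -- The increment of round `r` has been averaged by `A r, …, A (t - 1)`, and now also by `A t`,
      -- which is index `t - r` of the shifted sequence.
      have hsup : ∑ r ∈ Finset.range (t + 1),
          r * propagate (fun s => A (r + s)) D (t + 1 - r) i = ∑ j, A t i j *
            ∑ r ∈ Finset.range (t + 1), r * propagate (fun s => A (r + s)) D (t - r) j := by
        simp only [Finset.mul_sum]
        rw [Finset.sum_comm]
        refine Finset.sum_congr rfl fun r hr => ?_
        have hrt : r ≤ t := Nat.lt_succ_iff.1 (Finset.mem_range.1 hr)
        rw [Nat.succ_sub hrt, propagate, Finset.mul_sum, Nat.add_sub_cancel' hrt]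
        exact Finset.sum_congr rfl fun j _ => by ring
      linarith
    rw [hψ t i hi, Finset.sum_range_succ _ (t + 1), Finset.sum_range_succ b (t + 1), Nat.sub_self,
      propagate]
    have := hL (t + 1) i hi
    linarith

theorem sum_range_succ_natCast (s : ℕ) :
    ∑ r ∈ Finset.range (s + 1), (r : ℝ) = s * (s + 1) / 2 := by
  induction s with
  | zero => simp
  | succ s ih => rw [Finset.sum_range_succ, ih]; push_cast; ring

/-- Averaging with increments that are asymptotically at most `-r D` yields quadratic decay. -/
theorem eventually_div_sq_le {V : Type*} [Fintype V] {G : Digraph V} {F : Finset V} {f m : ℕ}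
    (hreach : SourcesReachAll G F f m) {α : ℝ} (hα : 0 < α) {A : ℕ → V → V → ℝ}
    (hA : ∀ t i, i ∉ F → IsAveragingRow G F f m α i (A t i))
    {D : V → ℝ} (hD : ∀ i, i ∉ F → 0 ≤ D i) {δ : ℝ} (hδ : 0 ≤ δ)
    (hsource : ∀ H, IsReducedGraph G F f m H → ∀ P, IsSourceComponent F H P → ∃ j ∈ P, δ ≤ D j)
    (hstarved : ∀ i, i ∉ F → IsStarved G f m i → δ ≤ D i)
    {L ψ : ℕ → V → ℝ}
    (hL : ∀ i, i ∉ F → Tendsto (fun t : ℕ => L t i / t) atTop (𝓝 (-D i)))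
    (hψ0 : ∀ i, i ∉ F → ψ 0 i = 0)
    (hψ : ∀ t i, i ∉ F → ψ (t + 1) i = ∑ j, A t i j * ψ t j + L (t + 1) i)
    {i : V} (hi : i ∉ F) {c : ℝ} (hc : c < α ^ Fintype.card V * δ) :
    ∀ᶠ t : ℕ in atTop, ψ t i / (t : ℝ) ^ 2 ≤ -c / 2 := by
  classical
  set n := Fintype.card V
  set c₁ := α ^ n * δ with hc₁
  have hc₁nn : 0 ≤ c₁ := by positivity
  -- In units of `t ^ 2 / 2`, one `ε` pays for the error in the limit of `L t / t`, the other
  -- absorbs all terms linear in `t`.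
  obtain ⟨ε, hε, hεc⟩ : ∃ ε : ℝ, 0 < ε ∧ c₁ - c = 2 * ε := ⟨(c₁ - c) / 2, by linarith, by ring⟩
  have hK : ∀ j, ∃ K : ℝ, 0 ≤ K ∧ (j ∉ F → ∀ r : ℕ, L r j ≤ -(r * D j) + (ε * r + K)) := by
    intro j
    by_cases hj : j ∈ F
    · exact ⟨0, le_rfl, fun h => absurd hj h⟩
    obtain ⟨N, hN⟩ := eventually_atTop.1
      ((hL j hj).eventually (Iio_mem_nhds (show -D j < -D j + ε by linarith)))
    have hKnn : 0 ≤ ∑ r ∈ Finset.range (N + 1), |L r j + r * D j| :=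
      Finset.sum_nonneg fun _ _ => abs_nonneg _
    refine ⟨∑ r ∈ Finset.range (N + 1), |L r j + r * D j|, hKnn, fun _ r => ?_⟩
    -- Splitting at `N + 1` rather than `N` ensures `r > 0` in the second case, where `L r j / r` is
    -- used.
    by_cases hr : r < N + 1
    · have h1 := Finset.single_le_sum (f := fun r : ℕ => |L r j + r * D j|)
        (fun _ _ => abs_nonneg _) (Finset.mem_range.2 hr)
      have h2 := le_abs_self (L r j + r * D j)
      have h3 : 0 ≤ ε * r := by positivity
      linarith
    · have hrpos : (0 : ℝ) < r := by exact_mod_cast (show 0 < r by omega)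
      have := hN r (by omega)
      rw [div_lt_iff₀ hrpos] at this
      nlinarith
  choose K hKnn hK using hK
  set M := ∑ j, K j
  have hMnn : 0 ≤ M := Finset.sum_nonneg fun j _ => hKnn j
  have hbound := le_superposition hA (D := D) (b := fun r => ε * r + M) (by simpa using hMnn)
    (fun r j hj => (hK j hj r).trans (by
      have : K j ≤ M := Finset.single_le_sum (fun j _ => hKnn j) (Finset.mem_univ j)
      linarith)) hψ0 hψ
  -- `R + M` dominates the linear terms: `c₁ * n` from the missing last `n` rounds, `ε` from `ε * t
  -- * (t + 1) / 2`, and `2 * M` from `M * (t + 1)`.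
  set R := c₁ * n + ε + M with hR
  obtain ⟨T, hT⟩ := exists_nat_ge ((R + M) / (ε / 2))
  refine eventually_atTop.2 ⟨max T (n + 1), fun t ht => ?_⟩
  have hnt : n ≤ t := by omega
  have htpos : (1 : ℝ) ≤ t := by exact_mod_cast (show 1 ≤ t by omega)
  obtain ⟨s, rfl⟩ := Nat.exists_eq_add_of_le' hnt
  -- With `t = s + n`, increments of rounds `r ≤ s` have been averaged at least `n` times; the later
  -- ones are nonnegative and dropped.
  have hlow : c₁ * (s * (s + 1) / 2) ≤
      ∑ r ∈ Finset.range (s + n + 1), r * propagate (fun k => A (r + k)) D (s + n - r) i := by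
    rw [← sum_range_succ_natCast, Finset.mul_sum]
    calc _ ≤ ∑ r ∈ Finset.range (s + 1),
          r * propagate (fun k => A (r + k)) D (s + n - r) i := by
          refine Finset.sum_le_sum fun r hr => ?_
          rw [mul_comm]
          refine mul_le_mul_of_nonneg_left ?_ (Nat.cast_nonneg r)
          have := Finset.mem_range.1 hr
          exact pow_mul_le_propagate hreach hα (fun k => hA (r + k)) hD hδ hsource hstarved
            (by omega) hi
      _ ≤ _ := Finset.sum_le_sum_of_subset_of_nonneg
          (Finset.range_subset_range.2 (by omega)) fun r _ _ =>
          mul_nonneg (Nat.cast_nonneg r) (propagate_nonneg (fun k => hA (r + k)) hD _ i hi)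
  have hψle := hbound (s + n) i hi
  rw [Finset.sum_add_distrib, ← Finset.mul_sum, sum_range_succ_natCast, Finset.sum_const,
    Finset.card_range, nsmul_eq_mul] at hψle
  have hTt : R + M ≤ ε / 2 * ((s + n : ℕ) : ℝ) := by
    rw [mul_comm, ← div_le_iff₀ (by positivity)]
    exact hT.trans (by exact_mod_cast (show T ≤ s + n by omega))
  rw [div_le_iff₀ (by positivity)]
  push_cast at *
  set x : ℝ := (s : ℝ) + n with hx
  have hs : (s : ℝ) = x - n := by rw [hx]; ring
  rw [hs] at hlow
  have hn : (0 : ℝ) ≤ n := Nat.cast_nonneg n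
  have h1 := mul_le_mul_of_nonneg_right hTt (show (0 : ℝ) ≤ x by linarith)
  have h2 : 0 ≤ M * (x - 1) := mul_nonneg hMnn (by linarith)
  have h3 : 0 ≤ c₁ * (n * n) := by positivity
  have h4 : 0 ≤ c₁ * (x - n) := mul_nonneg hc₁nn (by rw [← hs]; positivity)
  have h5 : c = c₁ - 2 * ε := by linarith
  rw [h5]
  have h6 : 0 ≤ ε * x := by positivity
  nlinarith

/-! ### Beliefs along a run -/

section Beliefs

variable {V : Type*} [Fintype V] {Θ : Type*} [Fintype Θ] {S : V → Type*} {G : Digraph V}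
  {F : Finset V} {f : ℕ} {ℓ : (i : V) → Θ → S i → ℝ} {sig : ℕ → (i : V) → S i}

theorem Run.belief_pos (run : Run G F f ℓ sig) (hℓ : ∀ i θ x, 0 < ℓ i θ x) (t : ℕ) {i : V}
    (hi : i ∉ F) (θ : Θ) : 0 < run.belief t i θ := by
  have : Nonempty Θ := ⟨θ⟩
  cases t with
  | zero =>
    rw [run.init i hi]
    have : 0 < Fintype.card Θ := Fintype.card_pos
    positivity
  | succ t =>
    have hpos : ∀ θ, 0 < (∏ k ∈ Finset.Icc 1 (t + 1), ℓ i θ (sig k i)) *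
        Real.exp (run.eta (t + 1) i θ) := fun θ =>
      mul_pos (Finset.prod_pos fun k _ => hℓ i θ _) (Real.exp_pos _)
    rw [run.update t i hi]
    exact div_pos (hpos θ) (Finset.sum_pos (fun θ _ => hpos θ) Finset.univ_nonempty)

theorem Run.belief_le_one (run : Run G F f ℓ sig) (hℓ : ∀ i θ x, 0 < ℓ i θ x) (t : ℕ) {i : V}
    (hi : i ∉ F) (θ : Θ) : run.belief t i θ ≤ 1 := by
  have : Nonempty Θ := ⟨θ⟩
  cases t with
  | zero =>
    rw [run.init i hi]
    have : 1 ≤ Fintype.card Θ := Fintype.card_pos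
    rw [div_le_one (by positivity)]
    exact_mod_cast this
  | succ t =>
    have hpos : ∀ θ, 0 < (∏ k ∈ Finset.Icc 1 (t + 1), ℓ i θ (sig k i)) *
        Real.exp (run.eta (t + 1) i θ) := fun θ =>
      mul_pos (Finset.prod_pos fun k _ => hℓ i θ _) (Real.exp_pos _)
    rw [run.update t i hi, div_le_one (Finset.sum_pos (fun θ _ => hpos θ) Finset.univ_nonempty)]
    exact Finset.single_le_sum (fun θ _ => (hpos θ).le) (Finset.mem_univ θ)

theorem Run.log_belief_div_zero (run : Run G F f ℓ sig) {i : V} (hi : i ∉ F) (θ θ₀ : Θ) :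
    Real.log (run.belief 0 i θ / run.belief 0 i θ₀) = 0 := by
  have : Nonempty Θ := ⟨θ⟩
  have : 0 < Fintype.card Θ := Fintype.card_pos
  rw [run.init i hi, run.init i hi, div_self (by positivity), Real.log_one]

/-- The normalising sum cancels in the ratio, which makes the dynamics linear. The signal term is
the full sum from time `1`, not just the newest signal; this is the origin of the quadratic rate. -/
theorem Run.log_belief_div_succ (run : Run G F f ℓ sig) (hℓ : ∀ i θ x, 0 < ℓ i θ x) (t : ℕ)
    {i : V} (hi : i ∉ F) (θ θ₀ : Θ) {a : V → ℝ} (ha : ∀ j ∈ F, a j = 0)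
    (hη : ∀ θ, run.eta (t + 1) i θ = ∑ j, a j * Real.log (run.belief t j θ)) :
    Real.log (run.belief (t + 1) i θ / run.belief (t + 1) i θ₀) =
      ∑ j, a j * Real.log (run.belief t j θ / run.belief t j θ₀) +
        ∑ k ∈ Finset.Icc 1 (t + 1), Real.log (ℓ i θ (sig k i) / ℓ i θ₀ (sig k i)) := by
  have hlog : ∀ θ', Real.log ((∏ k ∈ Finset.Icc 1 (t + 1), ℓ i θ' (sig k i)) *
      Real.exp (run.eta (t + 1) i θ')) =
      ∑ k ∈ Finset.Icc 1 (t + 1), Real.log (ℓ i θ' (sig k i)) + run.eta (t + 1) i θ' := by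
    intro θ'
    rw [Real.log_mul (Finset.prod_pos fun k _ => hℓ i θ' _).ne' (Real.exp_pos _).ne', Real.log_exp,
      Real.log_prod fun k _ => (hℓ i θ' _).ne']
  have hpos : ∀ θ, 0 < (∏ k ∈ Finset.Icc 1 (t + 1), ℓ i θ (sig k i)) *
      Real.exp (run.eta (t + 1) i θ) := fun θ =>
    mul_pos (Finset.prod_pos fun k _ => hℓ i θ _) (Real.exp_pos _)
  have hsum : 0 < ∑ θ, (∏ k ∈ Finset.Icc 1 (t + 1), ℓ i θ (sig k i)) *
      Real.exp (run.eta (t + 1) i θ) :=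
    Finset.sum_pos (fun θ _ => hpos θ) ⟨θ, Finset.mem_univ θ⟩
  rw [run.update t i hi, run.update t i hi, div_div_div_cancel_right₀ hsum.ne',
    Real.log_div (hpos θ).ne' (hpos θ₀).ne', hlog, hlog, hη, hη]
  have h1 : ∑ k ∈ Finset.Icc 1 (t + 1), Real.log (ℓ i θ (sig k i) / ℓ i θ₀ (sig k i)) =
      ∑ k ∈ Finset.Icc 1 (t + 1), Real.log (ℓ i θ (sig k i)) -
        ∑ k ∈ Finset.Icc 1 (t + 1), Real.log (ℓ i θ₀ (sig k i)) := by
    rw [← Finset.sum_sub_distrib]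
    exact Finset.sum_congr rfl fun k _ => Real.log_div (hℓ i θ _).ne' (hℓ i θ₀ _).ne'
  have h2 : ∑ j, a j * Real.log (run.belief t j θ / run.belief t j θ₀) =
      ∑ j, a j * Real.log (run.belief t j θ) - ∑ j, a j * Real.log (run.belief t j θ₀) := by
    rw [← Finset.sum_sub_distrib]
    refine Finset.sum_congr rfl fun j _ => ?_
    by_cases hj : j ∈ F
    · simp [ha j hj]
    · rw [Real.log_div (run.belief_pos hℓ t hj θ).ne' (run.belief_pos hℓ t hj θ₀).ne', mul_sub]
  rw [h1, h2]
  ring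

/-- As the belief in `θ₀` is at most `1`, the belief in `θ` is at most the ratio, hence eventually
at most `exp (c * t ^ 2)`. -/
theorem Run.tendsto_belief_zero (run : Run G F f ℓ sig) (hℓ : ∀ i θ x, 0 < ℓ i θ x) {i : V}
    (hi : i ∉ F) (θ θ₀ : Θ) {c : ℝ} (hc : c < 0)
    (h : ∀ᶠ t : ℕ in atTop,
      Real.log (run.belief t i θ / run.belief t i θ₀) / (t : ℝ) ^ 2 ≤ c) :
    Tendsto (fun t => run.belief t i θ) atTop (𝓝 0) := by
  have hlim : Tendsto (fun t : ℕ => Real.exp (c * (t : ℝ) ^ 2)) atTop (𝓝 0) :=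
    Real.tendsto_exp_atBot.comp (((tendsto_pow_atTop two_ne_zero).comp
      tendsto_natCast_atTop_atTop).const_mul_atTop_of_neg hc)
  refine squeeze_zero' (.of_forall fun t => (run.belief_pos hℓ t hi θ).le) ?_ hlim
  filter_upwards [h, eventually_ge_atTop 1] with t ht ht1
  have h1 : (1 : ℝ) ≤ t := by exact_mod_cast ht1
  rw [div_le_iff₀ (by positivity)] at ht
  have h0 := run.belief_pos hℓ t hi θ₀
  have hθ := run.belief_pos hℓ t hi θ
  calc run.belief t i θ ≤ run.belief t i θ / run.belief t i θ₀ :=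
        le_div_self hθ.le h0 (run.belief_le_one hℓ t hi θ₀)
    _ = Real.exp (Real.log (run.belief t i θ / run.belief t i θ₀)) :=
        (Real.exp_log (div_pos hθ h0)).symm
    _ ≤ _ := Real.exp_le_exp.2 ht

end Beliefs

/-! ### Divergences -/

/-- Gibbs' inequality: apply `log u ≥ 1 - 1 / u` to the likelihood ratio and sum; the lower bounds
add up to `1 - 1 = 0`. -/
theorem klDivergence_nonneg {V Θ : Type*} {S : V → Type*} [∀ i, Fintype (S i)]
    {ℓ : (i : V) → Θ → S i → ℝ} (hℓ : ∀ i θ x, 0 < ℓ i θ x) (hℓ1 : ∀ i θ, ∑ x, ℓ i θ x = 1)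
    (j : V) (θ₀ θ : Θ) : 0 ≤ klDivergence ℓ j θ₀ θ := by
  calc (0 : ℝ) = ∑ x, (ℓ j θ₀ x - ℓ j θ x) := by rw [Finset.sum_sub_distrib, hℓ1, hℓ1, sub_self]
    _ ≤ _ := Finset.sum_le_sum fun x _ => by
      have h := Real.one_sub_inv_le_log_of_pos (div_pos (hℓ j θ₀ x) (hℓ j θ x))
      have hne := (hℓ j θ₀ x).ne'
      calc ℓ j θ₀ x - ℓ j θ x = ℓ j θ₀ x * (1 - (ℓ j θ₀ x / ℓ j θ x)⁻¹) := by
            rw [inv_div]; field_simp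
        _ ≤ _ := mul_le_mul_of_nonneg_left h (hℓ j θ₀ x).le

section MinDivergence

variable {V : Type*} [Fintype V] {Θ : Type*} [Fintype Θ] {S : V → Type*} [∀ i, Fintype (S i)]
  {G : Digraph V} {F : Finset V} {f : ℕ} {ℓ : (i : V) → Θ → S i → ℝ} {θ₀ : Θ}

theorem minDivergence_le (hℓ : ∀ i θ x, 0 < ℓ i θ x) (hℓ1 : ∀ i θ, ∑ x, ℓ i θ x = 1)
    {θ : Θ} (hθ : θ ≠ θ₀) {P : Finset V}
    (hP : (∃ H, IsReducedGraph G F f (Fintype.card Θ) H ∧ IsSourceComponent F H P) ∨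
      ∃ i, i ∉ F ∧ IsStarved G f (Fintype.card Θ) i ∧ P = {i}) :
    minDivergence G F f ℓ θ₀ ≤ ∑ j ∈ P, klDivergence ℓ j θ₀ θ := by
  refine csInf_le ⟨0, ?_⟩ ⟨θ, hθ, P, hP, rfl⟩
  rintro _ ⟨θ, -, P, -, rfl⟩
  exact Finset.sum_nonneg fun j _ => klDivergence_nonneg hℓ hℓ1 j θ₀ θ

/-- Witness that reduced graphs exist, so that `minDivergence` is not the infimum of the empty set
and `nu` is not zero. -/
theorem isReducedGraph_deleteFaulty (G : Digraph V) (F : Finset V) (f m : ℕ) :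
    IsReducedGraph G F f m ⟨fun j i => G.Adj j i ∧ j ∉ F ∧ i ∉ F⟩ where
  sub _ _ h := h
  removed i hi := by
    refine (Finset.card_eq_zero.2 (Finset.eq_empty_of_forall_notMem fun j hj => ?_)).trans_le
      (Nat.zero_le _)
    simp only [Finset.mem_filter, Finset.mem_univ, true_and] at hj
    exact hj.2.2 ⟨hj.2.1, hj.1, hi⟩

/-- The infimum runs over a finite non-empty set, so it is attained, at a sum that is nonnegative
and by assumption nonzero. -/
theorem minDivergence_pos (hℓ : ∀ i θ x, 0 < ℓ i θ x) (hℓ1 : ∀ i θ, ∑ x, ℓ i θ x = 1)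
    (hreach : SourcesReachAll G F f (Fintype.card Θ)) (hdist : SourcesDistinguish G F f ℓ θ₀)
    (hstarved : ∀ i, i ∉ F → IsStarved G f (Fintype.card Θ) i →
      ∀ θ, θ ≠ θ₀ → klDivergence ℓ i θ₀ θ ≠ 0)
    {θ : Θ} (hθ : θ ≠ θ₀) : 0 < minDivergence G F f ℓ θ₀ := by
  have hmem : minDivergence G F f ℓ θ₀ ∈ {c : ℝ | ∃ θ, θ ≠ θ₀ ∧ ∃ P : Finset V,
      ((∃ H, IsReducedGraph G F f (Fintype.card Θ) H ∧ IsSourceComponent F H P) ∨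
        ∃ i, i ∉ F ∧ IsStarved G f (Fintype.card Θ) i ∧ P = {i}) ∧
      c = ∑ j ∈ P, klDivergence ℓ j θ₀ θ} := by
    refine Set.Nonempty.csInf_mem ?_ ?_
    · have hH := isReducedGraph_deleteFaulty G F f (Fintype.card Θ)
      obtain ⟨P, hP⟩ := (hreach _ hH).1
      exact ⟨_, θ, hθ, P, .inl ⟨_, hH, hP⟩, rfl⟩
    · refine (Set.finite_range fun p : Θ × Finset V =>
        ∑ j ∈ p.2, klDivergence ℓ j θ₀ p.1).subset ?_
      rintro _ ⟨θ, -, P, -, rfl⟩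
      exact ⟨(θ, P), rfl⟩
  obtain ⟨θ, hθ, P, hP, heq⟩ := hmem
  rw [heq]
  refine lt_of_le_of_ne (Finset.sum_nonneg fun j _ => klDivergence_nonneg hℓ hℓ1 j θ₀ θ) ?_
  rcases hP with ⟨H, hH, hP⟩ | ⟨i, hi, his, rfl⟩
  · exact (hdist θ hθ H hH P hP).symm
  · simpa using (hstarved i hi his θ hθ).symm

/-- A positive exponent is what yields `β ^ ν ≤ β`. -/
theorem nu_pos {G : Digraph V} {F : Finset V} {f m : ℕ} {i : V} (hi : i ∉ F) :
    0 < nu G F f m := by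
  classical
  refine Nat.mul_pos ?_ ?_
  · exact (Set.ncard_pos (Set.toFinite _)).2 ⟨_, isReducedGraph_deleteFaulty G F f m⟩
  · have : F.card < Fintype.card V :=
      Finset.card_lt_univ_of_notMem hi
    omega

end MinDivergence

/-! ### The log-likelihood ratios -/

/-- The strong law of large numbers for a function of i.i.d. signals with finitely many values. -/
theorem ae_tendsto_sum_Icc_div {S : Type*} [Fintype S] [MeasurableSpace S]
    [DiscreteMeasurableSpace S] {Ω : Type*} [MeasurableSpace Ω] {Pr : Measure Ω}
    [IsProbabilityMeasure Pr] {p : S → ℝ} {X : ℕ → Ω → S}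
    (hX : ∀ t, 1 ≤ t → Measurable (X t)) (hlaw : ∀ t, 1 ≤ t → ∀ x, Pr.real (X t ⁻¹' {x}) = p x)
    (hind : iIndepFun (fun t : ℕ => X (t + 1)) Pr) (g : S → ℝ) :
    ∀ᵐ ω ∂Pr, Tendsto (fun t : ℕ => (∑ k ∈ Finset.Icc 1 t, g (X k ω)) / t) atTop
      (𝓝 (∑ x, p x * g x)) := by
  have hg : Measurable g := .of_discrete
  have hmeas : ∀ t, Measurable (X (t + 1)) := fun t => hX _ (by omega)
  have hprob : ∀ t, IsProbabilityMeasure (Pr.map (X (t + 1))) := fun t =>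
    Measure.isProbabilityMeasure_map (hmeas t).aemeasurable
  have hreal : ∀ t x, (Pr.map (X (t + 1))).real {x} = p x := fun t x => by
    rw [map_measureReal_apply (hmeas t) (MeasurableSet.of_discrete), hlaw _ (by omega)]
  have hint : Integrable g (Pr.map (X 1)) := by
    have := hprob 0
    exact Integrable.of_finite
  have hE : Pr[fun ω => g (X 1 ω)] = ∑ x, p x * g x := by
    rw [← integral_map (hmeas 0).aemeasurable hg.aestronglyMeasurable, integral_fintype hint]
    exact Finset.sum_congr rfl fun x _ => by rw [hreal 0 x, smul_eq_mul]
  have hlaw_eq : ∀ t, Pr.map (X (t + 1)) = Pr.map (X 1) := fun t => by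
    have := hprob t
    have := hprob 0
    refine Measure.ext_of_singleton fun x => ?_
    exact (measureReal_eq_measureReal_iff).1 ((hreal t x).trans (hreal 0 x).symm)
  have hslln := strong_law_ae_real (μ := Pr) (fun k ω => g (X (k + 1) ω))
    (hint.comp_measurable (hmeas 0))
    (fun a b hab => (hind.indepFun hab).comp hg hg)
    (fun t => (⟨(hmeas t).aemeasurable, (hmeas 0).aemeasurable, hlaw_eq t⟩ :
      IdentDistrib (X (t + 1)) (X 1) Pr Pr).comp hg)
  filter_upwards [hslln] with ω hω
  simp only [zero_add] at hω
  rw [hE] at hω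
  -- Signals are numbered from `1`, the strong law from `0`.
  refine hω.congr fun t => ?_
  rw [Finset.range_eq_Ico, Finset.sum_Ico_add' (fun k => g (X k ω)) 0 t 1]
  rfl

end ByzantineLearning

open ByzantineLearning in
theorem theorem1
    {V : Type*} [Fintype V] {Θ : Type*} [Fintype Θ]
    (G : Digraph V) (f : ℕ) (F : Finset V) (hF : F.card ≤ f)
    (hreach : SourcesReachAll G F f (Fintype.card Θ)) :
    -- the constant `β` depends only on the network, the fault set, `f` and the states
    ∃ β : ℝ, 0 < β ∧ β < 1 ∧
      ∀ (S : V → Type*) [∀ i, Fintype (S i)] [∀ i, MeasurableSpace (S i)]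
        [∀ i, DiscreteMeasurableSpace (S i)]
        (ℓ : (i : V) → Θ → S i → ℝ)
        (_ : ∀ i θ x, 0 < ℓ i θ x) (_ : ∀ i θ, ∑ x, ℓ i θ x = 1)
        (θ₀ : Θ)
        (_ : SourcesDistinguish G F f ℓ θ₀)
        -- an agent that has too few in-neighbours to form a Tverberg point distinguishes alone
        (_ : ∀ i, i ∉ F → IsStarved G f (Fintype.card Θ) i →
          ∀ θ, θ ≠ θ₀ → klDivergence ℓ i θ₀ θ ≠ 0)
        (Ω : Type*) [MeasurableSpace Ω] (Pr : Measure Ω) [IsProbabilityMeasure Pr]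
        -- the signals of each non-faulty agent: i.i.d. over time with law `ℓ i θ₀`
        (sig : ℕ → (i : V) → Ω → S i)
        (_ : ∀ i, i ∉ F → ∀ t, 1 ≤ t → Measurable (sig t i))
        (_ : ∀ i, i ∉ F → ∀ t, 1 ≤ t → ∀ x, Pr.real (sig t i ⁻¹' {x}) = ℓ i θ₀ x)
        (_ : ∀ i, i ∉ F → iIndepFun (fun t : ℕ => sig (t + 1) i) Pr)
        (run : (ω : Ω) → Run G F f ℓ (fun t i => sig t i ω)),
        ∀ i, i ∉ F → ∀ θ, θ ≠ θ₀ → ∀ᵐ ω ∂Pr,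
          Tendsto (fun t => (run ω).belief t i θ) atTop (𝓝 0) ∧
          ∀ᶠ t : ℕ in atTop,
            Real.log ((run ω).belief t i θ / (run ω).belief t i θ₀) / (t : ℝ) ^ 2 ≤
              -(β ^ nu G F f (Fintype.card Θ) * minDivergence G F f ℓ θ₀) /
                (2 * (Fintype.card V : ℝ)) := by
  classical
  set n := Fintype.card V with hn
  set m := Fintype.card Θ with hm
  set α := weightBound n f m
  have hα : 0 < α := weightBound_pos n f m
  have hαn : 0 < α ^ n := pow_pos hα n
  have hαn1 : α ^ n ≤ 1 := pow_le_one₀ hα.le (weightBound_le_one n f m)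
  -- Halving makes `β ^ ν ≤ β < α ^ n` strict, and this gap absorbs the lower-order terms.
  refine ⟨α ^ n / 2, by positivity, by linarith, ?_⟩
  intro S _ _ _ ℓ hℓ hℓ1 θ₀ hdist hstarved Ω _ Pr _ sig hmeas hlaw hind run i hi θ hθ
  set C₁ := minDivergence G F f ℓ θ₀
  set β := α ^ n / 2 with hβ
  have hβ0 : 0 < β := by positivity
  have hC₁ : 0 < C₁ := minDivergence_pos hℓ hℓ1 hreach hdist hstarved hθ
  have hn1 : (1 : ℝ) ≤ n := by exact_mod_cast (Fintype.card_pos_iff.2 ⟨i⟩ : 0 < Fintype.card V)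
  have hnpos : (0 : ℝ) < n := by linarith
  have hpow : β ^ nu G F f m ≤ β :=
    pow_le_of_le_one hβ0.le (by linarith) (nu_pos hi).ne'
  have hpowpos : 0 < β ^ nu G F f m := pow_pos hβ0 _
  have hD : ∀ j, 0 ≤ klDivergence ℓ j θ₀ θ := fun j => klDivergence_nonneg hℓ hℓ1 j θ₀ θ
  -- The exceptional null set concerns the signals alone; outside it the argument is deterministic,
  -- whatever the faulty agents send.
  have hllr : ∀ᵐ ω ∂Pr, ∀ j, j ∉ F → Tendsto (fun t : ℕ =>
      (∑ k ∈ Finset.Icc 1 t, Real.log (ℓ j θ (sig k j ω) / ℓ j θ₀ (sig k j ω))) / t) atTop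
      (𝓝 (-klDivergence ℓ j θ₀ θ)) := by
    refine ae_all_iff.2 fun j => ?_
    by_cases hj : j ∈ F
    · exact .of_forall fun ω h => absurd hj h
    filter_upwards [ae_tendsto_sum_Icc_div (hmeas j hj) (hlaw j hj) (hind j hj)
      fun x => Real.log (ℓ j θ x / ℓ j θ₀ x)] with ω hω _
    convert hω using 2
    rw [klDivergence, ← Finset.sum_neg_distrib]
    refine Finset.sum_congr rfl fun x _ => ?_
    rw [← mul_neg, ← Real.log_inv, inv_div]
  filter_upwards [hllr] with ω hω
  choose a ha hη using fun (t : ℕ) (j : {j // j ∉ F}) => (run ω).exists_averagingRow hF t j.2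
  -- The zero rows of faulty agents are placeholders: no non-faulty row gives them weight.
  let A : ℕ → V → V → ℝ := fun t j => if hj : j ∉ F then a t ⟨j, hj⟩ else 0
  have hAeq : ∀ t j (hj : j ∉ F), A t j = a t ⟨j, hj⟩ := fun t j hj => dif_pos hj
  have hA : ∀ t j, j ∉ F → IsAveragingRow G F f m α j (A t j) := fun t j hj => by
    rw [hAeq t j hj]
    exact ha t ⟨j, hj⟩
  have hc : -(β ^ nu G F f m * C₁) / (2 * (n : ℝ)) = -(β ^ nu G F f m * (C₁ / n)) / 2 := by
    field_simp
  have hδ : 0 < C₁ / n := by positivity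
  rw [hc]
  have hmain := eventually_div_sq_le hreach hα hA (D := fun j => klDivergence ℓ j θ₀ θ)
    (fun j _ => hD j) hδ.le
    (fun H hH P hP => by
      -- The divergences over `P` sum to at least `C₁` and `P` has at most `n` members, so one of
      -- them has at least `C₁ / n`.
      by_contra! hlt
      have h1 := Finset.sum_lt_sum_of_nonempty hP.nonempty hlt
      have h2 := minDivergence_le hℓ hℓ1 hθ (.inl ⟨H, hH, hP⟩)
      rw [Finset.sum_const, nsmul_eq_mul] at h1
      have h3 : (P.card : ℝ) * (C₁ / n) ≤ n * (C₁ / n) := by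
        gcongr
        exact Finset.card_le_univ P
      rw [mul_div_cancel₀ _ hnpos.ne'] at h3
      exact absurd h2 (not_le.2 (h1.trans_le h3)))
    (fun j hj hjs => by
      have h2 := minDivergence_le hℓ hℓ1 hθ (.inr ⟨j, hj, hjs, rfl⟩)
      rw [Finset.sum_singleton] at h2
      exact (div_le_self hC₁.le hn1).trans h2)
    (ψ := fun t j => Real.log ((run ω).belief t j θ / (run ω).belief t j θ₀))
    hω (fun j hj => (run ω).log_belief_div_zero hj θ θ₀)
    (fun t j hj => (run ω).log_belief_div_succ hℓ t hj θ θ₀ (hA t j hj).faulty fun θ' => by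
      rw [hη t ⟨j, hj⟩ θ', hAeq t j hj])
    hi (c := β ^ nu G F f m * (C₁ / n)) (by gcongr; linarith)
  exact ⟨(run ω).tendsto_belief_zero hℓ hi θ θ₀
    (by have := mul_pos hpowpos hδ; linarith) hmain, hmain⟩
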